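/- Let $N\ge 3$ be an integer, $\zeta_N=\exp(2\pi\sqrt{-1}/N)$, and let $F(N)=\{(X:Y:Z)\in\mathbb{C}P^2 : X^N+Y^N=Z^N\}$ be the Fermat curve, with affine coordinates $x=X/Z$, $y=Y/Z$ and automorphisms $\alpha(X:Y:Z)=(\zeta_N X:Y:Z)$, $\beta(X:Y:Z)=(X:\zeta_N Y:Z)$. Put $Q_j=\beta^j(0,1)$ in the coordinates $(x,y)$. Let $\gamma_0$ be the path $[0,1]\ni t\mapsto (x,y)=(t,\sqrt[N]{1-t^N})$, with the real nonnegative root. Writing $\ell_1\cdot\ell_2$ for the path that traverses $\ell_1$ first and then $\ell_2$, put $$\kappa_0=\gamma_0\cdot(\beta\gamma_0)^{-1}\cdot(\alpha\beta\gamma_0)\cdot(\alpha\gamma_0)^{-1},\qquad \gamma_j=\gamma_0\cdot(\beta^j\gamma_0)^{-1},\qquad \gamma_{i,j}=\gamma_j\cdot(\alpha^i\beta^j\kappa_0)\cdot\gamma_j^{-1}\qquad(i,j\in\mathbb{Z}),$$ where in $\gamma_{i,0}$ the conjugating path is $\gamma_0\cdot\gamma_0^{-1}$, the case $j=0$ of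 the formula for $\gamma_j$ (everywhere else $\gamma_0$ denotes the path above). Each $\gamma_{i,j}$ is a loop based at $Q_0$. For integers $r,s\ge 1$ with $r+s\le N-1$ let $$\omega_{r,s}=\frac{N}{B(r/N,s/N)}\,\frac{x^{r-1}y^{s-1}\,dx}{y^{N-1}},$$ where $B$ is the beta function. For a path $C$ and $1$-forms $\omega_1,\omega_2$ with $C^*\omega_k=f_k(t)\,dt$ on $[0,1]$, the iterated integral is $\int_C\omega_1\omega_2=\int_{0\le t_1\le t_2\le 1}f_1(t_1)f_2(t_2)\,dt_1dt_2$. Let $r,s,l,m\ge 1$ be integers with $r+s\le N-1$ and $l+m\le N-1$, and let $i,j\in\mathbb{Z}$. Then the iterated integrals $\int_{\gamma_0}\omega_{r,s}\omega_{l,m}$ and $\int_{\gamma_{i,j}}\omega_{r,s}\omega_{l,m}$ converge absolutely; the first one is the real number $$x_{r,s,l,m}=\frac{N^2}{B(r/N,s/N)\,B(l/N,m/N)}\int_{0\le t_1\le t_2\le 1}t_1^{r-1}\big(\sqrt[N]{1-t_1^N}\big)^{s-N}\,t_2^{l-1}\big(\sqrt[N]{1-t_2^N}\big)^{m-N}\,dt_1dt_2,$$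 and \begin{align*} \int_{\gamma_{i,j}}\omega_{r,s}\omega_{l,m}={}&\zeta_N^{i(r+l)+j(s+m)}\big\{(1-\zeta_N^{l+r})(1-\zeta_N^{m+s})\,x_{r,s,l,m}+(1-\zeta_N^s)(\zeta_N^{l+r}+\zeta_N^{l+m}-\zeta_N^m-\zeta_N^l)\big\}\\ &+(1-\zeta_N^{js})(1-\zeta_N^l)(1-\zeta_N^m)\,\zeta_N^{il+jm}-(1-\zeta_N^{jm})(1-\zeta_N^r)(1-\zeta_N^s)\,\zeta_N^{ir+js}. \end{align*} -/

import Mathlib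

noncomputable section

namespace FermatCurve

open MeasureTheory
open scoped unitInterval LinearAlgebra.Projectivization

/-- The complex projective plane `ℂP²`. -/
abbrev CP2 : Type := ℙ ℂ (Fin 3 → ℂ)

/-- `ℂP²` carries the quotient topology from `ℂ³ \ {0}`. -/
instance : TopologicalSpace CP2 :=
  TopologicalSpace.coinduced (Projectivization.mk' ℂ) inferInstance

/-- The Fermat curve `F(N) = {(X : Y : Z) ∈ ℂP² ; X ^ N + Y ^ N = Z ^ N}` (the equation does not
depend on the representative, see `mk_mem_curve`). -/
def curve (N : ℕ) : Set CP2 := {P | P.rep 0 ^ N + P.rep 1 ^ N = P.rep 2 ^ N}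

theorem mk_mem_curve (N : ℕ) (v : Fin 3 → ℂ) (hv : v ≠ 0) :
    Projectivization.mk ℂ v hv ∈ curve N ↔ v 0 ^ N + v 1 ^ N = v 2 ^ N := by
  obtain ⟨a, ha⟩ := Projectivization.exists_smul_eq_mk_rep ℂ v hv
  have ha0 : (a : ℂ) ^ N ≠ 0 := pow_ne_zero _ a.ne_zero
  simp only [curve, Set.mem_ofPred_eq, ← ha, Units.smul_def, Pi.smul_apply, smul_eq_mul, mul_pow,
    ← mul_add]
  exact mul_right_inj' ha0

/-- The affine coordinate `x = X / Z` on `F(N)` (with value `0` at the points at infinity). -/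
def x {N : ℕ} (p : curve N) : ℂ := p.1.rep 0 / p.1.rep 2

/-- The affine coordinate `y = Y / Z` on `F(N)` (with value `0` at the points at infinity). -/
def y {N : ℕ} (p : curve N) : ℂ := p.1.rep 1 / p.1.rep 2

theorem x_mk {N : ℕ} (v : Fin 3 → ℂ) (hv : v ≠ 0) (h : Projectivization.mk ℂ v hv ∈ curve N) :
    x (⟨Projectivization.mk ℂ v hv, h⟩ : curve N) = v 0 / v 2 := by
  obtain ⟨a, ha⟩ := Projectivization.exists_smul_eq_mk_rep ℂ v hv
  simp only [x, ← ha, Units.smul_def, Pi.smul_apply, smul_eq_mul]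
  exact mul_div_mul_left _ _ a.ne_zero

theorem y_mk {N : ℕ} (v : Fin 3 → ℂ) (hv : v ≠ 0) (h : Projectivization.mk ℂ v hv ∈ curve N) :
    y (⟨Projectivization.mk ℂ v hv, h⟩ : curve N) = v 1 / v 2 := by
  obtain ⟨a, ha⟩ := Projectivization.exists_smul_eq_mk_rep ℂ v hv
  simp only [y, ← ha, Units.smul_def, Pi.smul_apply, smul_eq_mul]
  exact mul_div_mul_left _ _ a.ne_zero

theorem affine_ne_zero (a b : ℂ) : (![a, b, 1] : Fin 3 → ℂ) ≠ 0 := fun h => by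
  simpa using congrFun h 2

/-- The point of `F(N)` with affine coordinates `(a, b)`, that is, `(a : b : 1)`. -/
def affine (N : ℕ) (a b : ℂ) (h : a ^ N + b ^ N = 1) : curve N :=
  ⟨Projectivization.mk ℂ ![a, b, 1] (affine_ne_zero a b),
    (mk_mem_curve N _ _).2 (by simpa using h)⟩

/-- The linear map `(X, Y, Z) ↦ (aX, bY, Z)`. -/
def diagLin (a b : ℂ) : (Fin 3 → ℂ) →ₗ[ℂ] (Fin 3 → ℂ) where
  toFun v := ![a * v 0, b * v 1, v 2]
  map_add' v w := by
    ext k; fin_cases k <;> simp [mul_add]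
  map_smul' c v := by
    ext k; fin_cases k <;> simp [mul_left_comm]

theorem diagLin_injective {a b : ℂ} (ha : a ≠ 0) (hb : b ≠ 0) :
    Function.Injective (diagLin a b) := by
  intro v w h
  have h0 := congrFun h 0
  have h1 := congrFun h 1
  have h2 := congrFun h 2
  simp only [diagLin, LinearMap.coe_mk, AddHom.coe_mk, Matrix.cons_val_zero,
    Matrix.cons_val_one, Matrix.cons_val] at h0 h1 h2
  ext k
  fin_cases k
  · exact mul_left_cancel₀ ha h0
  · exact mul_left_cancel₀ hb h1
  · exact h2

theorem continuous_diagLin_map {a b : ℂ} (ha : a ≠ 0) (hb : b ≠ 0) :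
    Continuous (Projectivization.map (diagLin a b) (diagLin_injective ha hb) : CP2 → CP2) := by
  have hmk : Continuous (Projectivization.mk' ℂ : {v : Fin 3 → ℂ // v ≠ 0} → CP2) :=
    continuous_coinduced_rng
  refine continuous_coinduced_dom.2 ?_
  have hlin : Continuous (diagLin a b) := (diagLin a b).continuous_of_finiteDimensional
  exact hmk.comp (Continuous.subtype_mk (hlin.comp continuous_subtype_val)
    (fun v => (map_ne_zero_iff _ (diagLin_injective ha hb)).2 v.2))

theorem ne_zero_of_pow_eq_one {N : ℕ} [NeZero N] {a : ℂ} (ha : a ^ N = 1) : a ≠ 0 := by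
  rintro rfl
  simp [NeZero.ne N] at ha

/-- The map `(X : Y : Z) ↦ (aX : bY : Z)` of `F(N)` to itself, for `N`-th roots of unity `a, b`. -/
def diagMap {N : ℕ} [NeZero N] (a b : ℂ) (ha : a ^ N = 1) (hb : b ^ N = 1) (p : curve N) :
    curve N :=
  ⟨Projectivization.map (diagLin a b)
      (diagLin_injective (ne_zero_of_pow_eq_one ha) (ne_zero_of_pow_eq_one hb)) p.1, by
    obtain ⟨p, hp⟩ := p
    induction p using Projectivization.ind with
    | h v hv =>
      rw [mk_mem_curve] at hp
      rw [Projectivization.map_mk, mk_mem_curve]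
      simpa [diagLin, mul_pow, ha, hb] using hp⟩

theorem diagMap_mk {N : ℕ} [NeZero N] (a b : ℂ) (ha : a ^ N = 1) (hb : b ^ N = 1)
    (v : Fin 3 → ℂ) (hv : v ≠ 0) (h : Projectivization.mk ℂ v hv ∈ curve N) :
    (diagMap a b ha hb ⟨Projectivization.mk ℂ v hv, h⟩).1 =
      Projectivization.mk ℂ (diagLin a b v) ((map_ne_zero_iff _ (diagLin_injective
        (ne_zero_of_pow_eq_one ha) (ne_zero_of_pow_eq_one hb))).2 hv) := rfl

theorem diagMap_diagMap {N : ℕ} [NeZero N] (a b c d : ℂ) (ha : a ^ N = 1) (hb : b ^ N = 1)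
    (hc : c ^ N = 1) (hd : d ^ N = 1) (hac : a * c = 1) (hbd : b * d = 1) (p : curve N) :
    diagMap a b ha hb (diagMap c d hc hd p) = p := by
  obtain ⟨p, hp⟩ := p
  induction p using Projectivization.ind with
  | h v hv =>
    refine Subtype.ext ?_
    change Projectivization.mk ℂ (diagLin a b (diagLin c d v)) _ = Projectivization.mk ℂ v hv
    congr 1
    ext k
    fin_cases k <;> simp [diagLin, ← mul_assoc, hac, hbd]

theorem continuous_diagMap {N : ℕ} [NeZero N] (a b : ℂ) (ha : a ^ N = 1) (hb : b ^ N = 1) :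
    Continuous (diagMap a b ha hb : curve N → curve N) :=
  Continuous.subtype_mk ((continuous_diagLin_map (ne_zero_of_pow_eq_one ha)
    (ne_zero_of_pow_eq_one hb)).comp continuous_subtype_val) _

/-- The automorphism `(X : Y : Z) ↦ (aX : bY : Z)` of `F(N)`, for `N`-th roots of unity `a, b`. -/
def diag {N : ℕ} [NeZero N] (a b : ℂ) (ha : a ^ N = 1) (hb : b ^ N = 1) : curve N ≃ₜ curve N where
  toFun := diagMap a b ha hb
  invFun := diagMap a⁻¹ b⁻¹ (by rw [inv_pow, ha, inv_one]) (by rw [inv_pow, hb, inv_one])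
  left_inv := diagMap_diagMap _ _ _ _ _ _ _ _
    (inv_mul_cancel₀ (ne_zero_of_pow_eq_one ha)) (inv_mul_cancel₀ (ne_zero_of_pow_eq_one hb))
  right_inv := diagMap_diagMap _ _ _ _ _ _ _ _
    (mul_inv_cancel₀ (ne_zero_of_pow_eq_one ha)) (mul_inv_cancel₀ (ne_zero_of_pow_eq_one hb))
  continuous_toFun := continuous_diagMap _ _ _ _
  continuous_invFun := continuous_diagMap _ _ _ _

/-- `ζ_N = exp(2π√-1 / N)`. -/
def zeta (N : ℕ) : ℂ := Complex.exp (2 * Real.pi * Complex.I / N)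

theorem zeta_pow (N : ℕ) [NeZero N] : zeta N ^ N = 1 :=
  (Complex.isPrimitiveRoot_exp N (NeZero.ne N)).pow_eq_one

/-- `α(X : Y : Z) = (ζ_N X : Y : Z)`. -/
def alpha (N : ℕ) [NeZero N] : curve N ≃ₜ curve N := diag (zeta N) 1 (zeta_pow N) (one_pow N)

/-- `β(X : Y : Z) = (X : ζ_N Y : Z)`. -/
def beta (N : ℕ) [NeZero N] : curve N ≃ₜ curve N := diag 1 (zeta N) (one_pow N) (zeta_pow N)

/-- `α ^ i β ^ j`, a power and product in the group of self-homeomorphisms. -/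
def aut (N : ℕ) [NeZero N] (i j : ℤ) : curve N ≃ₜ curve N := alpha N ^ i * beta N ^ j

/-- `P_i = α ^ i (1, 0)`. -/
def P (N : ℕ) [NeZero N] (i : ℤ) : curve N :=
  (alpha N ^ i) (affine N 1 0 (by simp [NeZero.ne N]))

/-- `Q_j = β ^ j (0, 1)`. -/
def Q (N : ℕ) [NeZero N] (j : ℤ) : curve N :=
  (beta N ^ j) (affine N 0 1 (by simp [NeZero.ne N]))

theorem zpow_apply_of_fixed {X : Type*} [TopologicalSpace X] (f : X ≃ₜ X) (p : X) (h : f p = p)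
    (i : ℤ) : (f ^ i) p = p := by
  have hinv : f⁻¹ p = p := by
    change f.symm p = p
    rw [Homeomorph.symm_apply_eq, h]
  induction i using Int.induction_on with
  | zero => rfl
  | succ n ih =>
    rw [zpow_add_one]
    change (f ^ (n : ℤ)) (f p) = p
    rw [h, ih]
  | pred n ih =>
    rw [zpow_sub_one]
    change (f ^ (-(n : ℤ))) (f⁻¹ p) = p
    rw [hinv, ih]

theorem alpha_beta_comm (N : ℕ) [NeZero N] : Commute (alpha N) (beta N) := by
  refine Homeomorph.ext fun p => ?_
  obtain ⟨p, hp⟩ := p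
  induction p using Projectivization.ind with
  | h v hv =>
    refine Subtype.ext ?_
    change Projectivization.mk ℂ (diagLin (zeta N) 1 (diagLin 1 (zeta N) v)) _ =
      Projectivization.mk ℂ (diagLin 1 (zeta N) (diagLin (zeta N) 1 v)) _
    congr 1
    ext k
    fin_cases k <;> simp [diagLin]

theorem aut_Q_zero (N : ℕ) [NeZero N] (i j : ℤ) : aut N i j (Q N 0) = Q N j := by
  rw [aut, ((alpha_beta_comm N).zpow_zpow i j).eq]
  change (beta N ^ j) ((alpha N ^ i) (affine N 0 1 (by simp [NeZero.ne N]))) = _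
  refine congrArg _ (zpow_apply_of_fixed _ _ (Subtype.ext ?_) i)
  change Projectivization.mk ℂ (diagLin (zeta N) 1 _) _ = Projectivization.mk ℂ _ _
  congr 1
  ext k
  fin_cases k <;> simp [diagLin]

theorem aut_P_zero (N : ℕ) [NeZero N] (i j : ℤ) : aut N i j (P N 0) = P N i := by
  change (alpha N ^ i) ((beta N ^ j) (affine N 1 0 (by simp [NeZero.ne N]))) = _
  refine congrArg _ (zpow_apply_of_fixed _ _ (Subtype.ext ?_) j)
  change Projectivization.mk ℂ (diagLin 1 (zeta N) _) _ = Projectivization.mk ℂ _ _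
  congr 1
  ext k
  fin_cases k <;> simp [diagLin]

/-- The real nonnegative root `(1 - t ^ N) ^ (1 / N)`. -/
def root (N : ℕ) (t : ℝ) : ℝ := (1 - t ^ N) ^ (1 / (N : ℝ))

theorem root_pow (N : ℕ) [NeZero N] (t : I) :
    ((t : ℝ) : ℂ) ^ N + (root N t : ℂ) ^ N = 1 := by
  have h : 0 ≤ 1 - (t : ℝ) ^ N := sub_nonneg.2 (pow_le_one₀ t.2.1 t.2.2)
  have h2 : root N t ^ N = 1 - (t : ℝ) ^ N := by
    rw [root, one_div, Real.rpow_inv_natCast_pow h (NeZero.ne N)]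
  rw [← Complex.ofReal_pow, ← Complex.ofReal_pow, h2]
  push_cast
  ring

/-- The path `γ_0(t) = (t, (1 - t ^ N) ^ (1 / N))`, from `Q_0` to `P_0`. -/
def gamma0 (N : ℕ) [NeZero N] : Path (Q N 0) (P N 0) where
  toFun t := affine N (t : ℝ) (root N t) (root_pow N t)
  continuous_toFun := by
    have hmk : Continuous (Projectivization.mk' ℂ : {v : Fin 3 → ℂ // v ≠ 0} → CP2) :=
      continuous_coinduced_rng
    refine Continuous.subtype_mk (hmk.comp (Continuous.subtype_mk
      (f := fun t : I => (![((t : ℝ) : ℂ), (root N t : ℂ), 1] : Fin 3 → ℂ)) ?_ fun t =>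
      affine_ne_zero ((t : ℝ) : ℂ) (root N t : ℂ))) _
    refine continuous_pi fun k => ?_
    fin_cases k
    · exact Complex.continuous_ofReal.comp continuous_subtype_val
    · refine Complex.continuous_ofReal.comp ?_
      exact (continuous_const.sub (continuous_subtype_val.pow N)).rpow_const
        fun _ => Or.inr (by positivity)
    · exact continuous_const
  source' := by
    refine Subtype.ext ?_
    change Projectivization.mk ℂ _ _ = Projectivization.mk ℂ _ _
    congr 1
    simp [root, NeZero.ne N]
  target' := by
    refine Subtype.ext ?_
    change Projectivization.mk ℂ _ _ = Projectivization.mk ℂ _ _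
    congr 1
    simp [root, NeZero.ne N]

/-- The path `α ^ i β ^ j γ_0`, from `Q_j` to `P_i`. -/
def autGamma0 (N : ℕ) [NeZero N] (i j : ℤ) : Path (Q N j) (P N i) :=
  ((gamma0 N).map (aut N i j).continuous).cast (aut_Q_zero N i j).symm (aut_P_zero N i j).symm

/-- The loop `κ_0 = γ_0 · (β γ_0)⁻¹ · (α β γ_0) · (α γ_0)⁻¹`. -/
def kappa0 (N : ℕ) [NeZero N] : Path (Q N 0) (Q N 0) :=
  (((gamma0 N).trans (autGamma0 N 0 1).symm).trans (autGamma0 N 1 1)).trans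
    (autGamma0 N 1 0).symm

/-- The loop `α ^ i β ^ j κ_0`, based at `Q_j`. -/
def autKappa0 (N : ℕ) [NeZero N] (i j : ℤ) : Path (Q N j) (Q N j) :=
  ((kappa0 N).map (aut N i j).continuous).cast (aut_Q_zero N i j).symm (aut_Q_zero N i j).symm

/-- The path `γ_j = γ_0 · (β ^ j γ_0)⁻¹`, from `Q_0` to `Q_j`. -/
def gammaPath (N : ℕ) [NeZero N] (j : ℤ) : Path (Q N 0) (Q N j) :=
  (gamma0 N).trans (autGamma0 N 0 j).symm

/-- The loop `γ_{i,j} = γ_j · (α ^ i β ^ j κ_0) · γ_j⁻¹`, based at `Q_0`. -/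
def gammaLoop (N : ℕ) [NeZero N] (i j : ℤ) : Path (Q N 0) (Q N 0) :=
  ((gammaPath N j).trans (autKappa0 N i j)).trans (gammaPath N j).symm

/-- A meromorphic 1-form on `F(N)` is `g dx` for a unique function `g`; it is represented by `g`.
(For a holomorphic form, the formula `g dx` breaks down only at the finitely many points where
`y = 0` or `Z = 0`; this affects pullbacks to a path only on a null set of parameters.) -/
abbrev OneForm (N : ℕ) : Type := curve N → ℂ

/-- `B(r/N, s/N)`. -/
def B (N r s : ℕ) : ℝ := ProbabilityTheory.beta ((r : ℝ) / N) ((s : ℝ) / N)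

/-- `ω'_{r,s} = x ^ (r - 1) y ^ (s - 1) dx / y ^ (N - 1)`. -/
def omega' (N r s : ℕ) : OneForm N := fun p => x p ^ (r - 1) * y p ^ (s - 1) / y p ^ (N - 1)

/-- `ω_{r,s} = N ω'_{r,s} / B(r/N, s/N)`. -/
def omega (N r s : ℕ) : OneForm N := fun p => N * omega' N r s p / (B N r s : ℂ)

/-- The function `f` with `C^* ω = f(t) dt` on `[0,1]`, for `ω = g dx`. -/
def pullback {N : ℕ} {p q : curve N} (C : Path p q) (g : OneForm N) (t : ℝ) : ℂ :=
  g (C.extend t) * deriv (fun u : ℝ => x (C.extend u)) t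

/-- The simplex `0 ≤ t₁ ≤ t₂ ≤ 1`. -/
def simplex : Set (ℝ × ℝ) := {t | 0 ≤ t.1 ∧ t.1 ≤ t.2 ∧ t.2 ≤ 1}

/-- The double integral that defines `∫_C ω₁ ω₂` converges absolutely. -/
def IterIntegrable {N : ℕ} {p q : curve N} (C : Path p q) (w₁ w₂ : OneForm N) : Prop :=
  IntegrableOn (fun t : ℝ × ℝ => pullback C w₁ t.1 * pullback C w₂ t.2) simplex

/-- Chen's iterated integral `∫_C ω₁ ω₂ = ∫_{0 ≤ t₁ ≤ t₂ ≤ 1} f₁(t₁) f₂(t₂) dt₁ dt₂`, where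
`C^* ω_k = f_k(t) dt`. -/
def iterIntegral {N : ℕ} {p q : curve N} (C : Path p q) (w₁ w₂ : OneForm N) : ℂ :=
  ∫ t in simplex, pullback C w₁ t.1 * pullback C w₂ t.2

/-- `f_{r,s} = t ^ (r - 1) ((1 - t ^ N) ^ (1 / N)) ^ (s - N)`. -/
def f (N r s : ℕ) (t : ℝ) : ℝ := t ^ (r - 1) * root N t ^ ((s : ℤ) - N)

/-- The real number `x_{r,s,l,m} = N² ∫_{0 ≤ t₁ ≤ t₂ ≤ 1} f_{r,s}(t₁) f_{l,m}(t₂) dt₁ dt₂ /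
(B(r/N, s/N) B(l/N, m/N))`. -/
def xInt (N r s l m : ℕ) : ℝ :=
  (N : ℝ) ^ 2 * (∫ t in simplex, f N r s t.1 * f N l m t.2) / (B N r s * B N l m)

end FermatCurve

end

/-!
Chen's formulas express line integrals and iterated integrals along composites and inverses of
paths through those along the pieces; conjugating a loop `K` by a path `C` changes `∫ w₁ w₂` by
`∫_C w₁ * ∫_K w₂ - ∫_C w₂ * ∫_K w₁`. Every form `ω_{r,s}` is an eigenvector of `α ^ i β ^ j`, with
eigenvalue `ζ ^ (i r + j s)`, so all the integrals reduce to those along `γ₀`. The substitution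
`u = t ^ N` turns `∫_{γ₀} ω_{r,s}` into the beta integral divided by `B(r/N, s/N)`, so it equals
`1`. The conjugating paths then contribute the last two terms of the formula, and the four sides of
`κ₀` contribute the first.
-/

noncomputable section

namespace FermatCurve

open MeasureTheory Set
open scoped Topology

section IteratedIntervalIntegral

variable {𝕜 : Type*} [RCLike 𝕜] {F G F' G' : ℝ → 𝕜} {a b c : ℝ}

/-- The iterated integral of `F du` followed by `G dt` from `a` to `b`. Written with oriented
interval integrals it makes sense for `b < a` as well, so that path reversal is an affine
substitution. -/
def iterIntervalIntegral (F G : ℝ → 𝕜) (a b : ℝ) : 𝕜 :=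
  ∫ t in a..b, (∫ u in a..t, F u) * G t

theorem intervalIntegrable_primitive_mul (hF : IntervalIntegrable F volume a b)
    (hG : IntervalIntegrable G volume a b) :
    IntervalIntegrable (fun t => (∫ u in a..t, F u) * G t) volume a b :=
  hG.continuousOn_mul (intervalIntegral.continuousOn_primitive_interval' hF left_mem_uIcc)

theorem iterIntervalIntegral_add_adjacent (hF : IntervalIntegrable F volume a b)
    (hF' : IntervalIntegrable F volume b c) (hG : IntervalIntegrable G volume a b)
    (hG' : IntervalIntegrable G volume b c) :
    iterIntervalIntegral F G a c =
      iterIntervalIntegral F G a b + iterIntervalIntegral F G b c +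
        (∫ t in a..b, F t) * ∫ t in b..c, G t := by
  have hsplit : EqOn (fun t => (∫ u in a..t, F u) * G t)
      (fun t => (∫ u in a..b, F u) * G t + (∫ u in b..t, F u) * G t) (uIcc b c) := fun t ht => by
    simp only
    rw [← add_mul, intervalIntegral.integral_add_adjacent_intervals hF
      (hF'.mono_set (uIcc_subset_uIcc_left ht))]
  have hconst := hG'.const_mul (∫ u in a..b, F u)
  have hprim := intervalIntegrable_primitive_mul hF' hG'
  have htail : IntervalIntegrable (fun t => (∫ u in a..t, F u) * G t) volume b c :=
    (hconst.add hprim).congr (hsplit.symm.mono uIoc_subset_uIcc)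
  unfold iterIntervalIntegral
  rw [← intervalIntegral.integral_add_adjacent_intervals
      (intervalIntegrable_primitive_mul hF hG) htail,
    intervalIntegral.integral_congr hsplit, intervalIntegral.integral_add hconst hprim,
    intervalIntegral.integral_const_mul]
  ring

theorem iterIntervalIntegral_symm (hF : IntervalIntegrable F volume a b)
    (hG : IntervalIntegrable G volume a b) :
    iterIntervalIntegral F G b a =
      (∫ t in a..b, F t) * (∫ t in a..b, G t) - iterIntervalIntegral F G a b := by
  have hround : iterIntervalIntegral F G a a = 0 := intervalIntegral.integral_same
  rw [iterIntervalIntegral_add_adjacent hF hF.symm hG hG.symm,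
    intervalIntegral.integral_symm a b (f := G)] at hround
  linear_combination hround

theorem iterIntervalIntegral_congr_Ioo (hab : a ≤ b) (hF : EqOn F F' (Ioo a b))
    (hG : EqOn G G' (Ioo a b)) :
    iterIntervalIntegral F G a b = iterIntervalIntegral F' G' a b :=
  intervalIntegral.integral_congr_Ioo_of_le hab fun _ ht => congrArg₂ (· * ·)
    (intervalIntegral.integral_congr_Ioo_of_le ht.1.le fun _ hu => hF ⟨hu.1, hu.2.trans ht.2⟩)
    (hG ht)

theorem iterIntervalIntegral_const_mul (p q : 𝕜) (F G : ℝ → 𝕜) (a b : ℝ) :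
    iterIntervalIntegral (fun t => p * F t) (fun t => q * G t) a b =
      p * q * iterIntervalIntegral F G a b := by
  simp only [iterIntervalIntegral, intervalIntegral.integral_const_mul, mul_mul_mul_comm p _ q]

theorem iterIntervalIntegral_ofReal (F G : ℝ → ℝ) (a b : ℝ) :
    iterIntervalIntegral (fun t => (F t : 𝕜)) (fun t => (G t : 𝕜)) a b =
      ((iterIntervalIntegral F G a b : ℝ) : 𝕜) := by
  simp only [iterIntervalIntegral, RCLike.intervalIntegral_ofReal, ← RCLike.ofReal_mul]

theorem iterIntervalIntegral_comp_mul_add (F G : ℝ → 𝕜) (a b k d : ℝ) :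
    iterIntervalIntegral (fun t => k • F (k * t + d)) (fun t => k • G (k * t + d)) a b =
      iterIntervalIntegral F G (k * a + d) (k * b + d) := by
  simp only [iterIntervalIntegral, intervalIntegral.integral_smul,
    intervalIntegral.smul_integral_comp_mul_add, mul_smul_comm]
  exact intervalIntegral.smul_integral_comp_mul_add
    (fun v => (∫ u in (k * a + d)..v, F u) * G v) k d

theorem measurableSet_simplex : MeasurableSet simplex :=
  ((isClosed_le continuous_const continuous_fst).inter
    ((isClosed_le continuous_fst continuous_snd).inter
      (isClosed_le continuous_snd continuous_const))).measurableSet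

theorem simplex_subset_Icc_prod_Icc : simplex ⊆ Icc (0 : ℝ) 1 ×ˢ Icc (0 : ℝ) 1 :=
  fun _ ht => ⟨⟨ht.1, ht.2.1.trans ht.2.2⟩, ⟨ht.1.trans ht.2.1, ht.2.2⟩⟩

theorem integrableOn_simplex_mul (hF : IntervalIntegrable F volume 0 1)
    (hG : IntervalIntegrable G volume 0 1) :
    IntegrableOn (fun t : ℝ × ℝ => F t.1 * G t.2) simplex := by
  rw [intervalIntegrable_iff_integrableOn_Icc_of_le zero_le_one] at hF hG
  have hsquare := Integrable.mul_prod hF hG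
  rw [Measure.prod_restrict] at hsquare
  exact IntegrableOn.mono_set hsquare simplex_subset_Icc_prod_Icc

theorem integral_indicator_simplex_mul (F G : ℝ → 𝕜) (t : ℝ) :
    ∫ u, simplex.indicator (fun z => F z.1 * G z.2) (u, t) =
      (Icc 0 1).indicator (fun t => (∫ u in (0 : ℝ)..t, F u) * G t) t := by
  by_cases ht : t ∈ Icc (0 : ℝ) 1
  · have hslice (u : ℝ) : simplex.indicator (fun z => F z.1 * G z.2) (u, t) =
        (Icc 0 t).indicator F u * G t := by
      have hmem : (u, t) ∈ simplex ↔ u ∈ Icc 0 t :=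
        ⟨fun h => ⟨h.1, h.2.1⟩, fun h => ⟨h.1, h.2, ht.2⟩⟩
      simp only [indicator, hmem, ite_mul, zero_mul]
    simp only [hslice]
    rw [integral_mul_const, integral_indicator measurableSet_Icc, integral_Icc_eq_integral_Ioc,
      ← intervalIntegral.integral_of_le ht.1, indicator_of_mem ht]
  · have hempty (u : ℝ) : (u, t) ∉ simplex := fun h => ht ⟨h.1.trans h.2.1, h.2.2⟩
    simp only [indicator_of_notMem (hempty _), indicator_of_notMem ht, integral_zero]

theorem setIntegral_simplex_mul (hF : IntervalIntegrable F volume 0 1)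
    (hG : IntervalIntegrable G volume 0 1) :
    ∫ t in simplex, F t.1 * G t.2 = iterIntervalIntegral F G 0 1 := by
  have hint := (integrable_indicator_iff measurableSet_simplex).2 (integrableOn_simplex_mul hF hG)
  rw [← integral_indicator measurableSet_simplex, Measure.volume_eq_prod,
    integral_prod_symm _ (by rwa [← Measure.volume_eq_prod])]
  simp only [integral_indicator_simplex_mul]
  rw [integral_indicator measurableSet_Icc, integral_Icc_eq_integral_Ioc,
    ← intervalIntegral.integral_of_le zero_le_one, iterIntervalIntegral]

end IteratedIntervalIntegral

section Chen

variable {N : ℕ} {p q p' q' : curve N}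

/-- The line integral `∫_C ω` converges absolutely. -/
def LineIntegrable (C : Path p q) (w : OneForm N) : Prop :=
  IntervalIntegrable (pullback C w) volume 0 1

/-- The line integral `∫_C ω`, computed like `iterIntegral` from the pullback of `ω` to `[0, 1]`. -/
def lineIntegral (C : Path p q) (w : OneForm N) : ℂ :=
  ∫ t in (0 : ℝ)..1, pullback C w t

theorem LineIntegrable.iterIntegrable {C : Path p q} {w₁ w₂ : OneForm N}
    (h₁ : LineIntegrable C w₁) (h₂ : LineIntegrable C w₂) : IterIntegrable C w₁ w₂ :=
  integrableOn_simplex_mul h₁ h₂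

theorem LineIntegrable.iterIntegral_eq {C : Path p q} {w₁ w₂ : OneForm N}
    (h₁ : LineIntegrable C w₁) (h₂ : LineIntegrable C w₂) :
    iterIntegral C w₁ w₂ = iterIntervalIntegral (pullback C w₁) (pullback C w₂) 0 1 :=
  setIntegral_simplex_mul h₁ h₂

section Reparametrization

variable {C : Path p q} {D : Path p' q'} {a b k d : ℝ}

theorem pullback_eqOn_Ioo (h : EqOn C.extend (fun t => D.extend (k * t + d)) (Icc a b))
    (w : OneForm N) :
    EqOn (pullback C w) (fun t => k • pullback D w (k * t + d)) (Ioo a b) := fun t ht => by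
  have hnear : (fun u => x (C.extend u)) =ᶠ[𝓝 t] fun u => x (D.extend (k * u + d)) := by
    filter_upwards [Ioo_mem_nhds ht.1 ht.2] with u hu
    rw [h (Ioo_subset_Icc_self hu)]
  simp only [pullback]
  rw [hnear.deriv_eq, h (Ioo_subset_Icc_self ht),
    deriv_comp_mul_left k (fun v => x (D.extend (v + d))) t,
    deriv_comp_add_const (fun v => x (D.extend v)) d (k * t), mul_smul_comm]

variable {a' b' : ℝ} (w w₁ w₂ : OneForm N)

theorem intervalIntegrable_pullback_of_eqOn
    (h : EqOn C.extend (fun t => D.extend (k * t + d)) (Icc a b)) (hab : a ≤ b) (hk : k ≠ 0)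
    (ha : k * a + d = a') (hb : k * b + d = b')
    (hD : IntervalIntegrable (pullback D w) volume a' b') :
    IntervalIntegrable (pullback C w) volume a b := by
  have hcomp := ((hD.comp_add_right d).comp_mul_left (c := k)).smul k
  rw [← ha, ← hb, add_sub_cancel_right, add_sub_cancel_right, mul_div_cancel_left₀ _ hk,
    mul_div_cancel_left₀ _ hk] at hcomp
  exact hcomp.congr_uIoo (by rw [uIoo_of_le hab]; exact (pullback_eqOn_Ioo h w).symm)

theorem integral_pullback_of_eqOn
    (h : EqOn C.extend (fun t => D.extend (k * t + d)) (Icc a b)) (hab : a ≤ b)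
    (ha : k * a + d = a') (hb : k * b + d = b') :
    ∫ t in a..b, pullback C w t = ∫ t in a'..b', pullback D w t := by
  rw [intervalIntegral.integral_congr_Ioo_of_le hab (pullback_eqOn_Ioo h w),
    intervalIntegral.integral_smul, intervalIntegral.smul_integral_comp_mul_add, ha, hb]

theorem iterIntervalIntegral_pullback_of_eqOn
    (h : EqOn C.extend (fun t => D.extend (k * t + d)) (Icc a b)) (hab : a ≤ b)
    (ha : k * a + d = a') (hb : k * b + d = b') :
    iterIntervalIntegral (pullback C w₁) (pullback C w₂) a b =
      iterIntervalIntegral (pullback D w₁) (pullback D w₂) a' b' := by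
  rw [iterIntervalIntegral_congr_Ioo hab (pullback_eqOn_Ioo h w₁) (pullback_eqOn_Ioo h w₂),
    iterIntervalIntegral_comp_mul_add, ha, hb]

end Reparametrization

theorem extend_symm_eqOn (C : Path p q) :
    EqOn C.symm.extend (fun t => C.extend (-1 * t + 1)) (Icc 0 1) := fun t _ => by
  simp only
  rw [Path.extend_symm_apply, neg_one_mul, neg_add_eq_sub]

theorem extend_trans_eqOn_left (C : Path p q) (D : Path q q') :
    EqOn (C.trans D).extend (fun t => C.extend (2 * t + 0)) (Icc 0 (1 / 2)) := fun t ht => by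
  simp only
  rw [Path.extend_trans_of_le_half _ _ ht.2, add_zero]

theorem extend_trans_eqOn_right (C : Path p q) (D : Path q q') :
    EqOn (C.trans D).extend (fun t => D.extend (2 * t + -1)) (Icc (1 / 2) 1) := fun t ht => by
  simp only
  rw [Path.extend_trans_of_half_le _ _ ht.1, sub_eq_add_neg]

section

variable {C : Path p q} {D : Path q q'} {w w₁ w₂ : OneForm N}

theorem LineIntegrable.symm (h : LineIntegrable C w) : LineIntegrable C.symm w :=
  intervalIntegrable_pullback_of_eqOn w (extend_symm_eqOn C) zero_le_one (by norm_num)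
    (by norm_num) (by norm_num) (IntervalIntegrable.symm h)

theorem lineIntegral_symm (C : Path p q) (w : OneForm N) :
    lineIntegral C.symm w = -lineIntegral C w := by
  rw [lineIntegral, lineIntegral, ← intervalIntegral.integral_symm]
  exact integral_pullback_of_eqOn w (extend_symm_eqOn C) zero_le_one (by norm_num) (by norm_num)

theorem iterIntegral_symm (h₁ : LineIntegrable C w₁) (h₂ : LineIntegrable C w₂) :
    iterIntegral C.symm w₁ w₂ = lineIntegral C w₁ * lineIntegral C w₂ - iterIntegral C w₁ w₂ := by
  rw [h₁.symm.iterIntegral_eq h₂.symm, h₁.iterIntegral_eq h₂, lineIntegral, lineIntegral,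
    ← iterIntervalIntegral_symm h₁ h₂]
  exact iterIntervalIntegral_pullback_of_eqOn w₁ w₂ (extend_symm_eqOn C) zero_le_one (by norm_num)
    (by norm_num)

theorem LineIntegrable.trans_left (D : Path q q') (h : LineIntegrable C w) :
    IntervalIntegrable (pullback (C.trans D) w) volume 0 (1 / 2) :=
  intervalIntegrable_pullback_of_eqOn w (extend_trans_eqOn_left C D) (by norm_num) (by norm_num)
    (by norm_num) (by norm_num) h

theorem LineIntegrable.trans_right (C : Path p q) (h : LineIntegrable D w) :
    IntervalIntegrable (pullback (C.trans D) w) volume (1 / 2) 1 :=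
  intervalIntegrable_pullback_of_eqOn w (extend_trans_eqOn_right C D) (by norm_num) (by norm_num)
    (by norm_num) (by norm_num) h

theorem LineIntegrable.trans (hC : LineIntegrable C w) (hD : LineIntegrable D w) :
    LineIntegrable (C.trans D) w :=
  IntervalIntegrable.trans (hC.trans_left D) (hD.trans_right C)

theorem integral_pullback_trans_left (C : Path p q) (D : Path q q') (w : OneForm N) :
    ∫ t in (0 : ℝ)..(1 / 2), pullback (C.trans D) w t = lineIntegral C w :=
  integral_pullback_of_eqOn w (extend_trans_eqOn_left C D) (by norm_num) (by norm_num)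
    (by norm_num)

theorem integral_pullback_trans_right (C : Path p q) (D : Path q q') (w : OneForm N) :
    ∫ t in (1 / 2 : ℝ)..1, pullback (C.trans D) w t = lineIntegral D w :=
  integral_pullback_of_eqOn w (extend_trans_eqOn_right C D) (by norm_num) (by norm_num)
    (by norm_num)

theorem lineIntegral_trans (hC : LineIntegrable C w) (hD : LineIntegrable D w) :
    lineIntegral (C.trans D) w = lineIntegral C w + lineIntegral D w := by
  rw [← integral_pullback_trans_left C D, ← integral_pullback_trans_right C D,
    intervalIntegral.integral_add_adjacent_intervals (hC.trans_left D) (hD.trans_right C),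
    lineIntegral]

theorem iterIntegral_trans (hC₁ : LineIntegrable C w₁) (hC₂ : LineIntegrable C w₂)
    (hD₁ : LineIntegrable D w₁) (hD₂ : LineIntegrable D w₂) :
    iterIntegral (C.trans D) w₁ w₂ =
      iterIntegral C w₁ w₂ + iterIntegral D w₁ w₂ + lineIntegral C w₁ * lineIntegral D w₂ := by
  rw [(hC₁.trans hD₁).iterIntegral_eq (hC₂.trans hD₂),
    iterIntervalIntegral_add_adjacent (hC₁.trans_left D) (hD₁.trans_right C) (hC₂.trans_left D)
      (hD₂.trans_right C),
    integral_pullback_trans_left, integral_pullback_trans_right,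
    iterIntervalIntegral_pullback_of_eqOn w₁ w₂ (extend_trans_eqOn_left C D) (by norm_num)
      (a' := 0) (b' := 1) (by norm_num) (by norm_num),
    iterIntervalIntegral_pullback_of_eqOn w₁ w₂ (extend_trans_eqOn_right C D) (by norm_num)
      (a' := 0) (b' := 1) (by norm_num) (by norm_num),
    hC₁.iterIntegral_eq hC₂, hD₁.iterIntegral_eq hD₂]

theorem iterIntegral_conj {K : Path q q} (hC₁ : LineIntegrable C w₁) (hC₂ : LineIntegrable C w₂)
    (hK₁ : LineIntegrable K w₁) (hK₂ : LineIntegrable K w₂) :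
    iterIntegral ((C.trans K).trans C.symm) w₁ w₂ =
      iterIntegral K w₁ w₂ + lineIntegral C w₁ * lineIntegral K w₂ -
        lineIntegral C w₂ * lineIntegral K w₁ := by
  rw [iterIntegral_trans (hC₁.trans hK₁) (hC₂.trans hK₂) hC₁.symm hC₂.symm,
    iterIntegral_trans hC₁ hC₂ hK₁ hK₂, iterIntegral_symm hC₁ hC₂, lineIntegral_trans hC₁ hK₁,
    lineIntegral_symm]
  ring

end

end Chen

section Automorphisms

theorem x_affine {N : ℕ} {a b : ℂ} (h : a ^ N + b ^ N = 1) : x (affine N a b h) = a :=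
  (x_mk _ _ _).trans (div_one a)

theorem y_affine {N : ℕ} {a b : ℂ} (h : a ^ N + b ^ N = 1) : y (affine N a b h) = b :=
  (y_mk _ _ _).trans (div_one b)

theorem pullback_map_cast {M N : ℕ} {p q : curve M} {p' q' : curve N} {φ : curve M → curve N}
    {w : OneForm M} {w' : OneForm N} {a χ : ℂ} (hφ : Continuous φ) (hx : ∀ p, x (φ p) = a * x p)
    (hw : ∀ p, w' (φ p) * a = χ * w p) (C : Path p q) (hp : p' = φ p) (hq : q' = φ q) (t : ℝ) :
    pullback ((C.map hφ).cast hp hq) w' t = χ * pullback C w t := by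
  have hext (u : ℝ) : ((C.map hφ).cast hp hq).extend u = φ (C.extend u) := rfl
  simp only [pullback, hext, hx, deriv_const_mul_field', ← mul_assoc, hw]

theorem apply_zpow_of_semiinvariant {X M : Type*} [TopologicalSpace X] [GroupWithZero M]
    (φ : X ≃ₜ X) (g : X → M) {c : M} (hc : c ≠ 0) (h : ∀ p, g (φ p) = c * g p) (i : ℤ) (p : X) :
    g ((φ ^ i) p) = c ^ i * g p := by
  induction i using Int.induction_on generalizing p with
  | zero => simp
  | succ n ih =>
    rw [zpow_add_one, zpow_add_one₀ hc]
    change g ((φ ^ (n : ℤ)) (φ p)) = _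
    rw [ih, h, mul_assoc]
  | pred n ih =>
    rw [zpow_sub_one, zpow_sub_one₀ hc]
    change g ((φ ^ (-(n : ℤ))) (φ.symm p)) = _
    have hsymm := h (φ.symm p)
    rw [Homeomorph.apply_symm_apply] at hsymm
    rw [ih, hsymm, mul_assoc, inv_mul_cancel_left₀ hc]

variable {N : ℕ} [NeZero N]

theorem x_diag (a b : ℂ) (ha : a ^ N = 1) (hb : b ^ N = 1) (p : curve N) :
    x (diag a b ha hb p) = a * x p := by
  obtain ⟨p, hp⟩ := p
  induction p using Projectivization.ind with
  | h v hv =>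
    refine (x_mk _ _ (diagMap a b ha hb ⟨Projectivization.mk ℂ v hv, hp⟩).2).trans ?_
    rw [x_mk]
    exact mul_div_assoc a (v 0) (v 2)

theorem y_diag (a b : ℂ) (ha : a ^ N = 1) (hb : b ^ N = 1) (p : curve N) :
    y (diag a b ha hb p) = b * y p := by
  obtain ⟨p, hp⟩ := p
  induction p using Projectivization.ind with
  | h v hv =>
    refine (y_mk _ _ (diagMap a b ha hb ⟨Projectivization.mk ℂ v hv, hp⟩).2).trans ?_
    rw [y_mk]
    exact mul_div_assoc b (v 1) (v 2)

theorem zeta_ne_zero (N : ℕ) : zeta N ≠ 0 := Complex.exp_ne_zero _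

theorem x_aut (i j : ℤ) (p : curve N) : x (aut N i j p) = zeta N ^ i * x p := by
  change x ((alpha N ^ i) ((beta N ^ j) p)) = _
  rw [apply_zpow_of_semiinvariant (alpha N) x (zeta_ne_zero N) (x_diag _ _ _ _),
    apply_zpow_of_semiinvariant (beta N) x one_ne_zero (x_diag _ _ _ _), one_zpow, one_mul]

theorem y_aut (i j : ℤ) (p : curve N) : y (aut N i j p) = zeta N ^ j * y p := by
  change y ((alpha N ^ i) ((beta N ^ j) p)) = _
  rw [apply_zpow_of_semiinvariant (alpha N) y one_ne_zero (y_diag _ _ _ _),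
    apply_zpow_of_semiinvariant (beta N) y (zeta_ne_zero N) (y_diag _ _ _ _), one_zpow, one_mul]

theorem pow_pred_div_pow_pred {M : Type*} [GroupWithZero M] {b : M} (hb : b ^ N = 1) {s : ℕ}
    (hs : 1 ≤ s) : b ^ (s - 1) / b ^ (N - 1) = b ^ s := by
  have hb0 : b ≠ 0 := by
    rintro rfl
    simp [NeZero.ne N] at hb
  have hexp : s - 1 + N = s + (N - 1) := by have := NeZero.pos N; omega
  rw [div_eq_iff (pow_ne_zero _ hb0), ← pow_add, ← hexp, pow_add, hb, mul_one]

section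

variable {r s l m : ℕ} (hr : 1 ≤ r) (hs : 1 ≤ s) (hl : 1 ≤ l) (hm : 1 ≤ m) (i j : ℤ)
include hr hs

-- A form is represented by its coefficient of `dx`; the factor `zeta N ^ i` on the left is the
-- one by which the automorphism multiplies `dx`.
theorem omega_aut (p : curve N) :
    omega N r s (aut N i j p) * zeta N ^ i = zeta N ^ (i * r + j * s) * omega N r s p := by
  have hpow : (zeta N ^ j) ^ N = 1 := by
    rw [← zpow_natCast, ← zpow_mul, mul_comm, zpow_mul, zpow_natCast, zeta_pow, one_zpow]
  calc
    omega N r s (aut N i j p) * zeta N ^ i =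
        (zeta N ^ i) ^ (r - 1) * zeta N ^ i * ((zeta N ^ j) ^ (s - 1) / (zeta N ^ j) ^ (N - 1)) *
          omega N r s p := by
      simp only [omega, omega', x_aut, y_aut, mul_pow]
      ring
    _ = zeta N ^ (i * r + j * s) * omega N r s p := by
      rw [pow_pred_div_pow_pred hpow hs, ← pow_succ, Nat.sub_add_cancel hr,
        zpow_add₀ (zeta_ne_zero N), zpow_mul, zpow_mul, zpow_natCast, zpow_natCast]

variable {p q p' q' : curve N} {C : Path p q} (hp : p' = aut N i j p) (hq : q' = aut N i j q)

theorem pullback_map_aut (C : Path p q) :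
    pullback ((C.map (aut N i j).continuous).cast hp hq) (omega N r s) =
      fun t => zeta N ^ (i * r + j * s) * pullback C (omega N r s) t :=
  funext fun t =>
    pullback_map_cast (aut N i j).continuous (x_aut i j) (omega_aut hr hs i j) C hp hq t

theorem LineIntegrable.map_aut (h : LineIntegrable C (omega N r s)) :
    LineIntegrable ((C.map (aut N i j).continuous).cast hp hq) (omega N r s) := by
  rw [LineIntegrable, pullback_map_aut hr hs]
  exact IntervalIntegrable.const_mul h _

theorem lineIntegral_map_aut (C : Path p q) :
    lineIntegral ((C.map (aut N i j).continuous).cast hp hq) (omega N r s) =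
      zeta N ^ (i * r + j * s) * lineIntegral C (omega N r s) := by
  rw [lineIntegral, pullback_map_aut hr hs, intervalIntegral.integral_const_mul, lineIntegral]

include hl hm in
theorem iterIntegral_map_aut (C : Path p q) :
    iterIntegral ((C.map (aut N i j).continuous).cast hp hq) (omega N r s) (omega N l m) =
      zeta N ^ (i * r + j * s) * zeta N ^ (i * l + j * m) *
        iterIntegral C (omega N r s) (omega N l m) := by
  rw [iterIntegral, pullback_map_aut hr hs, pullback_map_aut hl hm, iterIntegral,
    ← integral_const_mul]
  simp only [mul_mul_mul_comm]

end

end Automorphisms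

section Segment

variable {a b : ℝ}

theorem cpow_mul_one_sub_cpow_ofReal (a b : ℝ) {u : ℝ} (hu : u ∈ Icc (0 : ℝ) 1) :
    (u : ℂ) ^ ((a : ℂ) - 1) * (1 - (u : ℂ)) ^ ((b : ℂ) - 1) =
      ((u ^ (a - 1) * (1 - u) ^ (b - 1) : ℝ) : ℂ) := by
  push_cast [Complex.ofReal_cpow hu.1, Complex.ofReal_cpow (sub_nonneg.2 hu.2)]
  rfl

theorem intervalIntegrable_rpow_mul_one_sub_rpow (ha : 0 < a) (hb : 0 < b) :
    IntervalIntegrable (fun u : ℝ => u ^ (a - 1) * (1 - u) ^ (b - 1)) volume 0 1 := by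
  have hre := (intervalIntegrable_iff.1
    (Complex.betaIntegral_convergent (u := a) (v := b) ha hb)).re
  refine (intervalIntegrable_iff.2 hre).congr_uIoo fun u hu => ?_
  rw [uIoo_of_le zero_le_one] at hu
  simp only [cpow_mul_one_sub_cpow_ofReal a b (Ioo_subset_Icc_self hu), RCLike.re_to_complex,
    Complex.ofReal_re]

theorem integral_rpow_mul_one_sub_rpow (ha : 0 < a) (hb : 0 < b) :
    ∫ u in (0 : ℝ)..1, u ^ (a - 1) * (1 - u) ^ (b - 1) = ProbabilityTheory.beta a b := by
  rw [ProbabilityTheory.beta_eq_betaIntegralReal a b ha hb, Complex.betaIntegral,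
    intervalIntegral.integral_congr fun u hu =>
      cpow_mul_one_sub_cpow_ofReal a b (by rwa [uIcc_of_le zero_le_one] at hu),
    intervalIntegral.integral_ofReal, Complex.ofReal_re]

variable {N : ℕ} [NeZero N] {r s : ℕ}

theorem B_pos (hr : 1 ≤ r) (hs : 1 ≤ s) : 0 < B N r s := by
  have hN : (0 : ℝ) < N := Nat.cast_pos.2 (NeZero.pos N)
  exact ProbabilityTheory.beta_pos (div_pos (Nat.cast_pos.2 hr) hN)
    (div_pos (Nat.cast_pos.2 hs) hN)

theorem root_pos {t : ℝ} (ht : t ∈ Ioo (0 : ℝ) 1) : 0 < root N t :=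
  Real.rpow_pos_of_pos (sub_pos.2 (pow_lt_one₀ ht.1.le ht.2 (NeZero.ne N))) _

theorem root_zpow_sub {t : ℝ} (ht : t ∈ Icc (0 : ℝ) 1) (s : ℕ) :
    root N t ^ ((s : ℤ) - N) = (1 - t ^ N) ^ ((s : ℝ) / N - 1) := by
  have hN : (N : ℝ) ≠ 0 := Nat.cast_ne_zero.2 (NeZero.ne N)
  have hexp : 1 / (N : ℝ) * ((s : ℤ) - N : ℤ) = (s : ℝ) / N - 1 := by
    push_cast
    field_simp
  rw [root, ← Real.rpow_intCast, ← Real.rpow_mul (sub_nonneg.2 (pow_le_one₀ ht.1 ht.2)), hexp]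

theorem pow_rpow_mul_pow_pred (hr : 1 ≤ r) {t : ℝ} (ht : 0 < t) :
    (t ^ N) ^ ((r : ℝ) / N - 1) * t ^ (N - 1) = t ^ (r - 1) := by
  have hN : (N : ℝ) ≠ 0 := Nat.cast_ne_zero.2 (NeZero.ne N)
  have hexp : (N : ℝ) * ((r : ℝ) / N - 1) + (N - 1 : ℕ) = (r - 1 : ℕ) := by
    push_cast [hr, NeZero.one_le (n := N)]
    field_simp
    ring
  rw [← Real.rpow_natCast t N, ← Real.rpow_mul ht.le, ← Real.rpow_natCast, ← Real.rpow_natCast,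
    ← Real.rpow_add ht, hexp]

section

variable (N) (g : ℝ → ℝ)

omit [NeZero N] in
theorem natCast_mul_pow_pred_nonneg :
    ∀ t ∈ Ioo (min (0 : ℝ) 1) (max 0 1), 0 ≤ N * t ^ (N - 1) := fun t ht => by
  rw [min_eq_left zero_le_one] at ht
  exact mul_nonneg N.cast_nonneg (pow_nonneg ht.1.le _)

theorem integral_comp_pow_mul :
    ∫ t in (0 : ℝ)..1, g (t ^ N) * (N * t ^ (N - 1)) = ∫ u in (0 : ℝ)..1, g u := by
  have hsubst := intervalIntegral.integral_comp_mul_deriv_of_deriv_nonneg (g := g)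
    (continuous_pow N).continuousOn (fun t _ => hasDerivAt_pow N t) (natCast_mul_pow_pred_nonneg N)
  rwa [zero_pow (NeZero.ne N), one_pow] at hsubst

theorem intervalIntegrable_comp_pow_mul_iff :
    IntervalIntegrable (fun t => g (t ^ N) * (N * t ^ (N - 1))) volume 0 1 ↔
      IntervalIntegrable g volume 0 1 := by
  have hsubst := intervalIntegral.integrable_comp_mul_deriv_iff_of_deriv_nonneg (g := g)
    (continuous_pow N).continuousOn (fun t _ => hasDerivAt_pow N t) (natCast_mul_pow_pred_nonneg N)
  rwa [zero_pow (NeZero.ne N), one_pow] at hsubst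

end

theorem rpow_mul_one_sub_rpow_pow_mul (hr : 1 ≤ r) (s : ℕ) {t : ℝ} (ht : t ∈ Ioo (0 : ℝ) 1) :
    (t ^ N) ^ ((r : ℝ) / N - 1) * (1 - t ^ N) ^ ((s : ℝ) / N - 1) * (N * t ^ (N - 1)) =
      N * f N r s t := by
  rw [f, root_zpow_sub (Ioo_subset_Icc_self ht), ← pow_rpow_mul_pow_pred (N := N) hr ht.1]
  ring

theorem intervalIntegrable_f (hr : 1 ≤ r) (hs : 1 ≤ s) :
    IntervalIntegrable (f N r s) volume 0 1 := by
  have hN : (0 : ℝ) < N := Nat.cast_pos.2 (NeZero.pos N)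
  have hbeta := (intervalIntegrable_comp_pow_mul_iff N _).2
    (intervalIntegrable_rpow_mul_one_sub_rpow (div_pos (Nat.cast_pos.2 hr) hN)
      (div_pos (Nat.cast_pos.2 hs) hN))
  refine (hbeta.const_mul (N : ℝ)⁻¹).congr_uIoo fun t ht => ?_
  rw [uIoo_of_le zero_le_one] at ht
  exact (congrArg ((N : ℝ)⁻¹ * ·) (rpow_mul_one_sub_rpow_pow_mul hr s ht)).trans
    (inv_mul_cancel_left₀ hN.ne' _)

theorem integral_f (hr : 1 ≤ r) (hs : 1 ≤ s) : ∫ t in (0 : ℝ)..1, f N r s t = B N r s / N := by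
  have hN : (0 : ℝ) < N := Nat.cast_pos.2 (NeZero.pos N)
  rw [eq_div_iff hN.ne', mul_comm, ← intervalIntegral.integral_const_mul,
    ← intervalIntegral.integral_congr_Ioo_of_le zero_le_one fun _ ht =>
      rpow_mul_one_sub_rpow_pow_mul hr s ht,
    integral_comp_pow_mul N fun u => u ^ ((r : ℝ) / N - 1) * (1 - u) ^ ((s : ℝ) / N - 1),
    integral_rpow_mul_one_sub_rpow (div_pos (Nat.cast_pos.2 hr) hN)
      (div_pos (Nat.cast_pos.2 hs) hN), B]

theorem gamma0_extend {t : ℝ} (ht : t ∈ Icc (0 : ℝ) 1) :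
    (gamma0 N).extend t = affine N t (root N t) (root_pow N ⟨t, ht⟩) :=
  Path.extend_apply _ ht

theorem pullback_gamma0 (hs : 1 ≤ s) :
    EqOn (pullback (gamma0 N) (omega N r s))
      (fun t => ((N / B N r s * f N r s t : ℝ) : ℂ)) (Ioo 0 1) := fun t ht => by
  have hx : (fun u : ℝ => x ((gamma0 N).extend u)) =ᶠ[𝓝 t] fun u => (u : ℂ) := by
    filter_upwards [Ioo_mem_nhds ht.1 ht.2] with u hu
    rw [gamma0_extend (Ioo_subset_Icc_self hu), x_affine]
  have hderiv : deriv (fun u : ℝ => (u : ℂ)) t = 1 := Complex.ofRealCLM.hasDerivAt.deriv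
  have hexp : (s : ℤ) - N = (s - 1 : ℕ) - (N - 1 : ℕ) := by
    push_cast [hs, NeZero.one_le (n := N)]
    ring
  have hroot : root N t ^ ((s : ℤ) - N) = root N t ^ (s - 1) / root N t ^ (N - 1) := by
    rw [hexp, zpow_sub₀ (root_pos ht).ne', zpow_natCast, zpow_natCast]
  rw [pullback, hx.deriv_eq, hderiv, gamma0_extend (Ioo_subset_Icc_self ht), omega, omega',
    x_affine, y_affine]
  simp only [f, hroot]
  push_cast
  ring

section

variable {l m : ℕ} (hr : 1 ≤ r) (hs : 1 ≤ s) (hl : 1 ≤ l) (hm : 1 ≤ m)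
include hr hs

theorem lineIntegrable_gamma0 : LineIntegrable (gamma0 N) (omega N r s) := by
  have hf : IntervalIntegrable (fun t => ((N / B N r s * f N r s t : ℝ) : ℂ)) volume 0 1 :=
    intervalIntegrable_iff.2
      (intervalIntegrable_iff.1 ((intervalIntegrable_f hr hs).const_mul (N / B N r s))).ofReal
  exact hf.congr_uIoo (by rw [uIoo_of_le zero_le_one]; exact (pullback_gamma0 hs).symm)

theorem lineIntegral_gamma0 : lineIntegral (gamma0 N) (omega N r s) = 1 := by
  have hreal : ∫ t in (0 : ℝ)..1, N / B N r s * f N r s t = 1 := by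
    rw [intervalIntegral.integral_const_mul, integral_f hr hs,
      div_mul_div_cancel₀ (B_pos hr hs).ne', div_self (Nat.cast_ne_zero.2 (NeZero.ne N))]
  rw [lineIntegral, intervalIntegral.integral_congr_Ioo_of_le zero_le_one (pullback_gamma0 hs),
    intervalIntegral.integral_ofReal, hreal, Complex.ofReal_one]

include hl hm

theorem iterIntegral_gamma0 :
    iterIntegral (gamma0 N) (omega N r s) (omega N l m) = xInt N r s l m := by
  have hf := intervalIntegrable_f (N := N) hr hs
  have hg := intervalIntegrable_f (N := N) hl hm
  have hreal : iterIntervalIntegral (fun t => N / B N r s * f N r s t)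
      (fun t => N / B N l m * f N l m t) 0 1 = xInt N r s l m := by
    rw [iterIntervalIntegral_const_mul, ← setIntegral_simplex_mul hf hg, xInt]
    ring
  rw [(lineIntegrable_gamma0 hr hs).iterIntegral_eq (lineIntegrable_gamma0 hl hm),
    iterIntervalIntegral_congr_Ioo zero_le_one (pullback_gamma0 hs) (pullback_gamma0 hm), ← hreal]
  exact iterIntervalIntegral_ofReal _ _ 0 1

end

end Segment

section Loops

variable {N : ℕ} [NeZero N] {r s l m : ℕ} (hr : 1 ≤ r) (hs : 1 ≤ s) (hl : 1 ≤ l) (hm : 1 ≤ m)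
  (i j : ℤ)
include hr hs

theorem lineIntegrable_autGamma0 : LineIntegrable (autGamma0 N i j) (omega N r s) :=
  (lineIntegrable_gamma0 hr hs).map_aut hr hs i j _ _

theorem lineIntegral_autGamma0 :
    lineIntegral (autGamma0 N i j) (omega N r s) = zeta N ^ (i * r + j * s) := by
  rw [autGamma0, lineIntegral_map_aut hr hs, lineIntegral_gamma0 hr hs, mul_one]

theorem lineIntegrable_gammaPath : LineIntegrable (gammaPath N j) (omega N r s) :=
  (lineIntegrable_gamma0 hr hs).trans (lineIntegrable_autGamma0 hr hs 0 j).symm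

theorem lineIntegral_gammaPath :
    lineIntegral (gammaPath N j) (omega N r s) = 1 - zeta N ^ (j * s) := by
  rw [gammaPath, lineIntegral_trans (lineIntegrable_gamma0 hr hs)
    (lineIntegrable_autGamma0 hr hs 0 j).symm, lineIntegral_symm, lineIntegral_gamma0 hr hs,
    lineIntegral_autGamma0 hr hs, zero_mul, zero_add, sub_eq_add_neg]

theorem lineIntegrable_kappa0 : LineIntegrable (kappa0 N) (omega N r s) :=
  ((lineIntegrable_gammaPath hr hs 1).trans (lineIntegrable_autGamma0 hr hs 1 1)).trans
    (lineIntegrable_autGamma0 hr hs 1 0).symm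

theorem lineIntegral_kappa0 :
    lineIntegral (kappa0 N) (omega N r s) = (1 - zeta N ^ r) * (1 - zeta N ^ s) := by
  have hβ := lineIntegrable_gammaPath (N := N) hr hs 1
  have hαβ := lineIntegrable_autGamma0 (N := N) hr hs 1 1
  have hα := lineIntegrable_autGamma0 (N := N) hr hs 1 0
  change lineIntegral (((gammaPath N 1).trans _).trans _) _ = _
  rw [lineIntegral_trans (hβ.trans hαβ) hα.symm, lineIntegral_trans hβ hαβ, lineIntegral_symm,
    lineIntegral_gammaPath hr hs, lineIntegral_autGamma0 hr hs, lineIntegral_autGamma0 hr hs]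
  simp only [one_mul, zero_mul, add_zero, zpow_add₀ (zeta_ne_zero N), zpow_natCast]
  ring

theorem lineIntegrable_autKappa0 : LineIntegrable (autKappa0 N i j) (omega N r s) :=
  (lineIntegrable_kappa0 hr hs).map_aut hr hs i j _ _

theorem lineIntegral_autKappa0 :
    lineIntegral (autKappa0 N i j) (omega N r s) =
      zeta N ^ (i * r + j * s) * ((1 - zeta N ^ r) * (1 - zeta N ^ s)) := by
  rw [autKappa0, lineIntegral_map_aut hr hs, lineIntegral_kappa0 hr hs]

theorem lineIntegrable_gammaLoop : LineIntegrable (gammaLoop N i j) (omega N r s) :=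
  ((lineIntegrable_gammaPath hr hs j).trans (lineIntegrable_autKappa0 hr hs i j)).trans
    (lineIntegrable_gammaPath hr hs j).symm

include hl hm

theorem iterIntegral_autGamma0 :
    iterIntegral (autGamma0 N i j) (omega N r s) (omega N l m) =
      zeta N ^ (i * r + j * s) * zeta N ^ (i * l + j * m) * xInt N r s l m := by
  rw [autGamma0, iterIntegral_map_aut hr hs hl hm, iterIntegral_gamma0 hr hs hl hm]

theorem iterIntegral_gammaPath :
    iterIntegral (gammaPath N j) (omega N r s) (omega N l m) =
      (1 - zeta N ^ (j * s) * zeta N ^ (j * m)) * xInt N r s l m +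
        (zeta N ^ (j * s) - 1) * zeta N ^ (j * m) := by
  have h₁ := lineIntegrable_autGamma0 (N := N) hr hs 0 j
  have h₂ := lineIntegrable_autGamma0 (N := N) hl hm 0 j
  rw [gammaPath, iterIntegral_trans (lineIntegrable_gamma0 hr hs) (lineIntegrable_gamma0 hl hm)
    h₁.symm h₂.symm, iterIntegral_symm h₁ h₂, lineIntegral_symm, lineIntegral_gamma0 hr hs,
    lineIntegral_autGamma0 hr hs, lineIntegral_autGamma0 hl hm,
    iterIntegral_gamma0 hr hs hl hm, iterIntegral_autGamma0 hr hs hl hm]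
  simp only [zero_mul, zero_add]
  ring

theorem iterIntegral_kappa0 :
    iterIntegral (kappa0 N) (omega N r s) (omega N l m) =
      (1 - zeta N ^ (l + r)) * (1 - zeta N ^ (m + s)) * xInt N r s l m +
        (1 - zeta N ^ s) * (zeta N ^ (l + r) + zeta N ^ (l + m) - zeta N ^ m - zeta N ^ l) := by
  have hβ₁ := lineIntegrable_gammaPath (N := N) hr hs 1
  have hβ₂ := lineIntegrable_gammaPath (N := N) hl hm 1
  have hαβ₁ := lineIntegrable_autGamma0 (N := N) hr hs 1 1
  have hαβ₂ := lineIntegrable_autGamma0 (N := N) hl hm 1 1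
  have hα₁ := lineIntegrable_autGamma0 (N := N) hr hs 1 0
  have hα₂ := lineIntegrable_autGamma0 (N := N) hl hm 1 0
  change iterIntegral (((gammaPath N 1).trans _).trans _) _ _ = _
  rw [iterIntegral_trans (hβ₁.trans hαβ₁) (hβ₂.trans hαβ₂) hα₁.symm hα₂.symm,
    iterIntegral_trans hβ₁ hβ₂ hαβ₁ hαβ₂, iterIntegral_symm hα₁ hα₂, lineIntegral_trans hβ₁ hαβ₁,
    lineIntegral_symm]
  simp only [iterIntegral_gammaPath hr hs hl hm, iterIntegral_autGamma0 hr hs hl hm,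
    lineIntegral_gammaPath hr hs, lineIntegral_autGamma0 hr hs, lineIntegral_autGamma0 hl hm,
    one_mul, zero_mul, add_zero, zpow_add₀ (zeta_ne_zero N), zpow_natCast]
  ring

theorem iterIntegral_autKappa0 :
    iterIntegral (autKappa0 N i j) (omega N r s) (omega N l m) =
      zeta N ^ (i * (r + l) + j * (s + m)) *
        ((1 - zeta N ^ (l + r)) * (1 - zeta N ^ (m + s)) * xInt N r s l m +
          (1 - zeta N ^ s) *
            (zeta N ^ (l + r) + zeta N ^ (l + m) - zeta N ^ m - zeta N ^ l)) := by
  have hexp : i * (r + l) + j * (s + m) = i * r + j * s + (i * l + j * m) := by ring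
  rw [autKappa0, iterIntegral_map_aut hr hs hl hm, iterIntegral_kappa0 hr hs hl hm,
    ← zpow_add₀ (zeta_ne_zero N), hexp]

end Loops

end FermatCurve

end

open FermatCurve in
theorem mainTheorem2_general (N : ℕ) [NeZero N] (r s l m : ℕ)
    (hr : 1 ≤ r) (hs : 1 ≤ s) (hl : 1 ≤ l) (hm : 1 ≤ m) (i j : ℤ) :
    (IterIntegrable (gamma0 N) (omega N r s) (omega N l m) ∧
      iterIntegral (gamma0 N) (omega N r s) (omega N l m) = (xInt N r s l m : ℂ)) ∧
    IterIntegrable (gammaLoop N i j) (omega N r s) (omega N l m) ∧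
      iterIntegral (gammaLoop N i j) (omega N r s) (omega N l m) =
        zeta N ^ (i * (r + l) + j * (s + m)) *
            ((1 - zeta N ^ (l + r)) * (1 - zeta N ^ (m + s)) * (xInt N r s l m : ℂ) +
              (1 - zeta N ^ s) *
                (zeta N ^ (l + r) + zeta N ^ (l + m) - zeta N ^ m - zeta N ^ l)) +
          (1 - zeta N ^ (j * s)) * (1 - zeta N ^ l) * (1 - zeta N ^ m) *
            zeta N ^ (i * l + j * m) -
          (1 - zeta N ^ (j * m)) * (1 - zeta N ^ r) * (1 - zeta N ^ s) *
            zeta N ^ (i * r + j * s) := by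
  have hC₁ := lineIntegrable_gammaPath (N := N) hr hs j
  have hC₂ := lineIntegrable_gammaPath (N := N) hl hm j
  have hK₁ := lineIntegrable_autKappa0 (N := N) hr hs i j
  have hK₂ := lineIntegrable_autKappa0 (N := N) hl hm i j
  refine ⟨⟨(lineIntegrable_gamma0 hr hs).iterIntegrable (lineIntegrable_gamma0 hl hm),
    iterIntegral_gamma0 hr hs hl hm⟩,
    (lineIntegrable_gammaLoop hr hs i j).iterIntegrable (lineIntegrable_gammaLoop hl hm i j), ?_⟩
  rw [gammaLoop, iterIntegral_conj hC₁ hC₂ hK₁ hK₂, iterIntegral_autKappa0 hr hs hl hm,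
    lineIntegral_gammaPath hr hs, lineIntegral_gammaPath hl hm, lineIntegral_autKappa0 hr hs,
    lineIntegral_autKappa0 hl hm]
  ring

open FermatCurve in
theorem mainTheorem2 (N : ℕ) [NeZero N] (hN : 3 ≤ N) (r s l m : ℕ)
    (hr : 1 ≤ r) (hs : 1 ≤ s) (hrs : r + s ≤ N - 1)
    (hl : 1 ≤ l) (hm : 1 ≤ m) (hlm : l + m ≤ N - 1) (i j : ℤ) :
    (IterIntegrable (gamma0 N) (omega N r s) (omega N l m) ∧
      iterIntegral (gamma0 N) (omega N r s) (omega N l m) = (xInt N r s l m : ℂ)) ∧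
    IterIntegrable (gammaLoop N i j) (omega N r s) (omega N l m) ∧
      iterIntegral (gammaLoop N i j) (omega N r s) (omega N l m) =
        zeta N ^ (i * (r + l) + j * (s + m)) *
            ((1 - zeta N ^ (l + r)) * (1 - zeta N ^ (m + s)) * (xInt N r s l m : ℂ) +
              (1 - zeta N ^ s) *
                (zeta N ^ (l + r) + zeta N ^ (l + m) - zeta N ^ m - zeta N ^ l)) +
          (1 - zeta N ^ (j * s)) * (1 - zeta N ^ l) * (1 - zeta N ^ m) *
            zeta N ^ (i * l + j * m) -
          (1 - zeta N ^ (j * m)) * (1 - zeta N ^ r) * (1 - zeta N ^ s) *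
            zeta N ^ (i * r + j * s) :=
  mainTheorem2_general N r s l m hr hs hl hm i j
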